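/- Let $\kappa$ be an uncountable cardinal with $\kappa^{<\kappa}=\kappa$. Equip the set $2^\kappa$ of binary sequences of length $\kappa$ with the bounded topology, generated by the sets $\{x\in 2^\kappa : \sigma\subset x\}$ for binary sequences $\sigma$ of length less than $\kappa$. A $\kappa$-Turing machine is given by a finite program. It has tapes of length $\kappa$ whose cells contain $0$ or $1$ (by default $0$), each with one head: finitely many read-only input tapes, finitely many read-and-write scratch tapes, and one write-only output tape, which is one-way: each time a symbol is written on it, its head moves one cell to the right, and the head does not move otherwise. The machine starts in the initial state $0$ with all heads on cell $0$. At successor stages it behaves like a classical Turing machine (a head that moves left from cell $0$ or from a cell with limit index goes to cell $0$; a machine that has halted keeps its configuration). At limit stages the state (the states being numbered $0,\dots,m$), the content of each cell and the position of each head are the inferior limits of their earlier values. An oracle T2$\kappa$TM is such a machine with two read-only tapes, one for the input and one for the oracle. It computes a partial function $f:2^\kappa\to 2^\kappa$ with oracle $o\in 2^\kappa$ if, for every $x\in\operatorname{dom}(f)$, in the run with $x$ on the input tape and $o$ on the oracle tape, for every $\alpha<\kappa$ there is a stage $\beta<\kappa$ at which the first $\alpha$ cells of the output tape have been written on and contain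 $f(x)\upharpoonright\alpha$. Nothing is required for $x\notin\operatorname{dom}(f)$. **Theorem.** A partial function $f:2^\kappa\to 2^\kappa$ is continuous (as a function on $\operatorname{dom}(f)$ with the subspace topology) if and only if there are an oracle T2$\kappa$TM $M$ and $o\in 2^\kappa$ such that $M$ computes $f$ with oracle $o$. -/

import Mathlib

universe u

/-- The set `2^κ` of binary sequences of length `κ`; the positions are the ordinals below
the initial ordinal of `κ`. -/
def GenCantor (κ : Cardinal.{u}) : Type (u + 1) := Set.Iio κ.ord → Bool

namespace GenCantor

/-- The set of all `x ∈ 2^κ` that extend the sequence `σ` of length `α < κ`. -/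
def cone {κ : Cardinal.{u}} {α : Ordinal.{u}} (hα : α < κ.ord) (σ : Set.Iio α → Bool) :
    Set (GenCantor κ) :=
  {x | ∀ β : Set.Iio α, x ⟨β.1, lt_trans β.2 hα⟩ = σ β}

/-- The bounded topology on `2^κ`. -/
instance boundedTopology (κ : Cardinal.{u}) : TopologicalSpace (GenCantor κ) :=
  TopologicalSpace.generateFrom
    {U | ∃ (α : Ordinal.{u}) (hα : α < κ.ord) (σ : Set.Iio α → Bool), U = cone hα σ}

end GenCantor

namespace KappaTM

/-- The possible movements of a head in one step. -/
inductive Move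
  | left
  | stay
  | right

open Classical in
/-- The new position of a head at position `h`. Moving left from a position that is not a
successor ordinal (that is, from `0` or from a limit position) leads to position `0`. -/
noncomputable def Move.apply (m : Move) (h : Ordinal.{u}) : Ordinal.{u} :=
  match m with
  | .left => if ∃ a : Ordinal.{u}, h = a + 1 then Ordinal.pred h else 0
  | .stay => h
  | .right => h + 1

/-- What a machine with `m` states, `I` input tapes and `k` scratch tapes does in one step. -/
structure Action (m I k : ℕ) where
  /-- the next state -/
  next : Fin m
  /-- how the head on each input tape moves -/
  inputMove : Fin I → Move
  /-- the symbol that is written on the scanned cell of each scratch tape -/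
  scratchWrite : Fin k → Bool
  /-- how the head on each scratch tape moves, after the writing -/
  scratchMove : Fin k → Move
  /-- `some b`: write `b` on the scanned cell of the output tape and move the output head one
  cell to the right; `none`: leave the output tape and its head as they are -/
  output : Option Bool

/-- A `κ`-Turing machine with `I` read-only input tapes, finitely many scratch tapes and one
one-way write-only output tape. This is a finite program, which does not depend on `κ`: finitely
many states, the initial state `0`, and for each state and each combination of symbols
scanned on the input tapes and on the scratch tapes an action, or `none` if the machine halts. -/
structure Machine (I : ℕ) where
  /-- the states are `0, …, maxState` -/
  maxState : ℕ
  /-- the number of scratch tapes -/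
  scratch : ℕ
  /-- the transition function -/
  trans : Fin (maxState + 1) → (Fin I → Bool) → (Fin scratch → Bool) →
    Option (Action (maxState + 1) I scratch)

/-- The contents of a tape of length `κ`. -/
abbrev Tape (κ : Cardinal.{u}) : Type (u + 1) := Set.Iio κ.ord → Bool

open Classical in
/-- The symbol in cell `h`. In fewer than `κ` steps a head never leaves the tape, so the
default value is never used there. -/
noncomputable def Tape.read {κ : Cardinal.{u}} (T : Tape κ) (h : Ordinal.{u}) : Bool :=
  if hh : h < κ.ord then T ⟨h, hh⟩ else false

open Classical in
/-- The tape after `b` has been written on cell `h`. -/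
noncomputable def Tape.write {κ : Cardinal.{u}} (T : Tape κ) (h : Ordinal.{u}) (b : Bool) :
    Tape κ :=
  fun ξ => if ξ.1 = h then b else T ξ

/-- A machine configuration (the contents of the input tapes never change and are not
part of it). -/
structure Config (κ : Cardinal.{u}) {I : ℕ} (M : Machine I) where
  /-- the current state -/
  state : Fin (M.maxState + 1)
  /-- the head positions on the input tapes -/
  inputHead : Fin I → Ordinal.{u}
  /-- the contents of the scratch tapes -/
  scratch : Fin M.scratch → Tape κ
  /-- the head positions on the scratch tapes -/
  scratchHead : Fin M.scratch → Ordinal.{u}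
  /-- the contents of the output tape -/
  output : Tape κ
  /-- the head position on the output tape; exactly the cells below it have been written on -/
  outputHead : Ordinal.{u}

variable {κ : Cardinal.{u}} {I : ℕ}

/-- The initial configuration. -/
def initial (κ : Cardinal.{u}) (M : Machine I) : Config κ M where
  state := 0
  inputHead := fun _ => 0
  scratch := fun _ _ => false
  scratchHead := fun _ => 0
  output := fun _ => false
  outputHead := 0

/-- The configuration after `c` has carried out the action `a`. -/
noncomputable def perform {M : Machine I} (a : Action (M.maxState + 1) I M.scratch)
    (c : Config κ M) : Config κ M where
  state := a.next
  inputHead := fun i => (a.inputMove i).apply (c.inputHead i)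
  scratch := fun j => (c.scratch j).write (c.scratchHead j) (a.scratchWrite j)
  scratchHead := fun j => (a.scratchMove j).apply (c.scratchHead j)
  output := match a.output with
    | some b => c.output.write c.outputHead b
    | none => c.output
  outputHead := match a.output with
    | some _ => c.outputHead + 1
    | none => c.outputHead

/-- One step of the machine on the contents `p` of the input tapes. A machine that has halted
stays in its configuration forever. -/
noncomputable def step (M : Machine I) (p : Fin I → Tape κ) (c : Config κ M) : Config κ M :=
  match M.trans c.state (fun i => (p i).read (c.inputHead i))
      (fun j => (c.scratch j).read (c.scratchHead j)) with
  | some a => perform a c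
  | none => c

/-- The inferior limit at `t` of a sequence indexed by the ordinals below `t`. -/
noncomputable def liminfBelow {β : Type*} [ConditionallyCompleteLattice β] (t : Ordinal.{u})
    (v : Set.Iio t → β) : β :=
  Filter.liminf v Filter.atTop

/-- The configuration at a limit time `t`: the state, the contents of each cell and the
position of each head are the inferior limits of their earlier values. -/
noncomputable def limitConfig {M : Machine I} (t : Ordinal.{u})
    (c : Set.Iio t → Config κ M) : Config κ M where
  state := liminfBelow t fun s => (c s).state
  inputHead := fun i => liminfBelow t fun s => (c s).inputHead i
  scratch := fun j ξ => liminfBelow t fun s => (c s).scratch j ξ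
  scratchHead := fun j => liminfBelow t fun s => (c s).scratchHead j
  output := fun ξ => liminfBelow t fun s => (c s).output ξ
  outputHead := liminfBelow t fun s => (c s).outputHead

/-- The configuration at time `t` of the run of `M` on the contents `p` of the input tapes. -/
noncomputable def run (M : Machine I) (p : Fin I → Tape κ) (t : Ordinal.{u}) : Config κ M :=
  Ordinal.limitRecOn t (initial κ M) (fun _ c => step M p c)
    (fun t _ c => limitConfig t fun s => c s.1 s.2)

/-- The first `α` cells of the output tape have been written on, and contain the first `α`
symbols of `y`. -/
def HasWritten {M : Machine I} (c : Config κ M) (α : Ordinal.{u}) (y : GenCantor κ) : Prop :=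
  α ≤ c.outputHead ∧ ∀ ξ : Set.Iio κ.ord, ξ.1 < α → c.output ξ = y ξ

/-- The run of `M` on the contents `p` of the input tapes writes `y`: every proper initial
segment of `y` is written at some time before `κ`. -/
def Writes (M : Machine I) (p : Fin I → Tape κ) (y : GenCantor κ) : Prop :=
  ∀ α < κ.ord, ∃ β < κ.ord, HasWritten (run M p β) α y

/-- A type two `κ`-Turing machine with one input tape and one additional read-only tape, the
oracle tape. -/
abbrev OracleMachine : Type := Machine 2

/-- The oracle machine `M` computes the partial function `f` when the oracle `o` is written on
its oracle tape. Nothing is required for inputs outside the domain of `f`. -/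
def Computes (M : OracleMachine) (o : GenCantor κ) (f : GenCantor κ →. GenCantor κ) : Prop :=
  ∀ (x : GenCantor κ) (hx : x ∈ f.Dom), Writes M ![x, o] (f.fn x hx)

/-- The partial function `f` is computable with an oracle. -/
def ComputableWithOracle (f : GenCantor κ →. GenCantor κ) : Prop :=
  ∃ (M : OracleMachine) (o : GenCantor κ), Computes M o f

end KappaTM

/-- A partial function is continuous if it is continuous as a function on its domain with the
subspace topology. -/
def PartialContinuous {X Y : Type*} [TopologicalSpace X] [TopologicalSpace Y]
    (f : X →. Y) : Prop :=
  Continuous f.asSubtype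

/-! Computable implies continuous: within `β < κ` steps only the first `β` cells of an input tape
can be scanned (`run_congr`), and an output cell never changes once written (`output_mono`).

For the converse a single machine, `scanner`, serves every `f`; all information about `f` sits in
the oracle, a sequence of `κ` records. A record holds a word and at most one symbol, and the scanner
appends the symbol to the output if the input extends the word. The words run through all binary
sequences of length `ω * (γ + 1)` with `γ < κ.ord`, each occurring cofinally often
(`exists_cofinal_enumeration`).

The difficulty is that the output is one-way: a record must hold the symbol for the position that
the output head has reached by then, and this position may differ between inputs extending the same
word. Therefore `firstIndex` chooses, for each input, one record per initial segment, at indices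
that increase with the length, and all other records stay mute. Before the record chosen for a
segment, only those chosen for shorter segments can have added a symbol, so all inputs sharing the
segment have reached the same position (`listed_eq_of_agree`). By continuity a long enough segment
decides the symbol at that position, so the output passes every `α < κ` (`exists_le_listed`);
regularity of `κ` handles limits. -/

namespace KappaTM

open Order

/-! ### Inferior limits along ordinals. -/

section Liminf

variable {t : Ordinal.{u}}

theorem eventually_Iio_atTop (ht : IsSuccLimit t) {P : Ordinal.{u} → Prop} :
    (∀ᶠ s : Set.Iio t in Filter.atTop, P s) ↔ ∃ s < t, ∀ r, s ≤ r → r < t → P r := by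
  have : Nonempty (Set.Iio t) := ⟨⟨0, ht.bot_lt⟩⟩
  rw [Filter.eventually_atTop]
  constructor
  · rintro ⟨s, hs⟩
    exact ⟨s, s.2, fun r h h' => hs ⟨r, h'⟩ h⟩
  · rintro ⟨s, hs, h⟩
    exact ⟨⟨s, hs⟩, fun r hr => h r hr r.2⟩

variable {β : Type*} [ConditionallyCompleteLinearOrderBot β]

theorem liminfBelow_le (ht : IsSuccLimit t) {v : Ordinal.{u} → β} {L : β}
    (h : ∀ s < t, ∃ r, s ≤ r ∧ r < t ∧ v r ≤ L) :
    liminfBelow t (fun s => v s) ≤ L := by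
  refine Filter.liminf_le_of_le ⟨⊥, by simp⟩ fun b hb => ?_
  obtain ⟨s, hs, hb⟩ := (eventually_Iio_atTop (P := fun r => b ≤ v r) ht).1 hb
  obtain ⟨r, h1, h2, h3⟩ := h s hs
  exact (hb r h1 h2).trans h3

/-- `h'` keeps the set of eventual lower bounds bounded above, as a supremum in a conditionally
complete order requires. -/
theorem le_liminfBelow (ht : IsSuccLimit t) {v : Ordinal.{u} → β} {L L' : β}
    (h : ∃ s < t, ∀ r, s ≤ r → r < t → L ≤ v r)
    (h' : ∀ s < t, ∃ r, s ≤ r ∧ r < t ∧ v r ≤ L') :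
    L ≤ liminfBelow t (fun s => v s) := by
  refine Filter.le_liminf_of_le ⟨L', fun a ha => ?_⟩
    ((eventually_Iio_atTop (P := fun r => L ≤ v r) ht).2 h)
  obtain ⟨s, hs, hb⟩ := (eventually_Iio_atTop (P := fun r => a ≤ v r) ht).1 ha
  obtain ⟨r, h1, h2, h3⟩ := h' s hs
  exact (hb r h1 h2).trans h3

theorem liminfBelow_eq (ht : IsSuccLimit t) {v : Ordinal.{u} → β} {L : β}
    (h : ∃ s < t, ∀ r, s ≤ r → r < t → L ≤ v r)
    (h' : ∀ s < t, ∃ r, s ≤ r ∧ r < t ∧ v r ≤ L) :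
    liminfBelow t (fun s => v s) = L :=
  le_antisymm (liminfBelow_le ht h') (le_liminfBelow ht h h')

theorem liminfBelow_eq_of_eventually (ht : IsSuccLimit t) {v : Ordinal.{u} → β} {L : β}
    (h : ∃ s < t, ∀ r, s ≤ r → r < t → v r = L) :
    liminfBelow t (fun s => v s) = L := by
  obtain ⟨s, hs, h⟩ := h
  refine liminfBelow_eq ht ⟨s, hs, fun r h1 h2 => (h r h1 h2).ge⟩ fun s' hs' =>
    ⟨max s s', le_max_right _ _, max_lt hs hs', (h _ (le_max_left _ _) (max_lt hs hs')).le⟩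

theorem liminfBelow_eq_bot (ht : IsSuccLimit t) {v : Ordinal.{u} → β}
    (h' : ∀ s < t, ∃ r, s ≤ r ∧ r < t ∧ v r = ⊥) :
    liminfBelow t (fun s => v s) = ⊥ :=
  le_bot_iff.1 (liminfBelow_le ht fun s hs =>
    (h' s hs).imp fun _ h => ⟨h.1, h.2.1, h.2.2.le⟩)

/-- For head positions that increase to `L` without reaching it, eventual lower bounds exist only
below `L`. -/
theorem liminfBelow_ordinal_eq (ht : IsSuccLimit t) {v : Ordinal.{u} → Ordinal.{u}}
    {L : Ordinal.{u}}
    (h : ∀ a < L, ∃ s < t, ∀ r, s ≤ r → r < t → a < v r)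
    (h' : ∀ s < t, ∃ r, s ≤ r ∧ r < t ∧ v r ≤ L) :
    liminfBelow t (fun s => v s) = L := by
  refine le_antisymm (liminfBelow_le ht h') (le_of_forall_lt fun a ha => ?_)
  obtain ⟨s, hs, hh⟩ := h a ha
  exact (lt_add_one a).trans_le (le_liminfBelow ht
    ⟨s, hs, fun r h1 h2 => Order.add_one_le_of_lt (hh r h1 h2)⟩ h')

end Liminf

/-! ### Locality of runs and permanence of the output. -/

variable {κ : Cardinal.{u}} {I : ℕ} {M : Machine I} {p : Fin I → Tape κ}

theorem run_zero : run M p 0 = initial κ M :=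
  Ordinal.limitRecOn_zero ..

theorem run_add_one (t : Ordinal.{u}) : run M p (t + 1) = step M p (run M p t) :=
  Ordinal.limitRecOn_add_one ..

theorem run_limit {t : Ordinal.{u}} (ht : IsSuccLimit t) :
    run M p t = limitConfig t fun s => run M p s :=
  Ordinal.limitRecOn_limit _ _ _ _ ht

theorem Move.apply_le (m : Move) (h : Ordinal.{u}) : m.apply h ≤ h + 1 := by
  cases m with
  | left =>
    simp only [Move.apply]
    split_ifs
    · exact (Ordinal.pred_le_self h).trans le_self_add
    · exact zero_le
  | stay => exact le_self_add
  | right => exact le_rfl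

theorem inputHead_le (i : Fin I) (t : Ordinal.{u}) : (run M p t).inputHead i ≤ t := by
  induction t using Ordinal.limitRecOn with
  | zero => rw [run_zero]; exact le_rfl
  | add_one t ih =>
    rw [run_add_one, step]
    split
    · exact (Move.apply_le _ _).trans (by gcongr)
    · exact ih.trans le_self_add
  | limit t ht ih =>
    rw [run_limit ht]
    exact liminfBelow_le ht (v := fun s => (run M p s).inputHead i) fun s hs =>
      ⟨s, le_rfl, hs, (ih s hs).trans hs.le⟩

/-- At time `t` every input head is at or below cell `t`, so no cell from `β` on is scanned before
time `β`. -/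
theorem run_congr {q : Fin I → Tape κ} {β : Ordinal.{u}}
    (h : ∀ i, ∀ ξ < β, (p i).read ξ = (q i).read ξ) {t : Ordinal.{u}} (ht : t ≤ β) :
    run M p t = run M q t := by
  induction t using Ordinal.limitRecOn with
  | zero => rw [run_zero, run_zero]
  | add_one t ih =>
    have htβ : t < β := Order.add_one_le_iff.1 ht
    rw [run_add_one, run_add_one, ← ih htβ.le, step, step]
    have : (fun i => (p i).read ((run M p t).inputHead i)) =
        fun i => (q i).read ((run M p t).inputHead i) :=
      funext fun i => h i _ ((inputHead_le i t).trans_lt htβ)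
    rw [this]
  | limit t hl ih =>
    rw [run_limit hl, run_limit hl]
    congr 1
    exact funext fun s => ih s s.2 (s.2.le.trans ht)

theorem outputHead_step (c : Config κ M) :
    c.outputHead ≤ (step M p c).outputHead ∧
      ∀ ξ : Set.Iio κ.ord, ξ.1 < c.outputHead → (step M p c).output ξ = c.output ξ := by
  rw [step]
  split
  · rename_i a _
    simp only [perform]
    cases a.output with
    | none => simp
    | some b => exact ⟨le_self_add, fun ξ hξ => by simp [Tape.write, hξ.ne]⟩
  · simp

theorem output_mono {s t : Ordinal.{u}} (hst : s ≤ t) :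
    (run M p s).outputHead ≤ (run M p t).outputHead ∧
      ∀ ξ : Set.Iio κ.ord, ξ.1 < (run M p s).outputHead →
        (run M p t).output ξ = (run M p s).output ξ := by
  induction t using Ordinal.limitRecOn generalizing s with
  | zero => obtain rfl : s = 0 := by simpa using hst
            simp
  | add_one t ih =>
    rcases hst.lt_or_eq with h | rfl
    · obtain ⟨h1, h2⟩ := ih (Order.lt_add_one_iff.1 h)
      rw [run_add_one]
      obtain ⟨h3, h4⟩ := outputHead_step (p := p) (run M p t)
      exact ⟨h1.trans h3, fun ξ hξ => (h4 ξ (hξ.trans_le h1)).trans (h2 ξ hξ)⟩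
    · simp
  | limit t ht ih =>
    rcases hst.lt_or_eq with h | rfl
    · rw [run_limit ht]
      refine ⟨?_, fun ξ hξ => ?_⟩
      · have hb : ∃ B : Ordinal.{u}, ∀ r < t, (run M p r).outputHead ≤ B :=
          ⟨⨆ r : Set.Iio t, (run M p r).outputHead,
            fun r hr => Ordinal.le_iSup (fun r : Set.Iio t => (run M p r).outputHead) ⟨r, hr⟩⟩
        obtain ⟨B, hB⟩ := hb
        exact le_liminfBelow ht (v := fun s => (run M p s).outputHead) (L' := B)
          ⟨s, h, fun r h1 h2 => (ih r h2 h1).1⟩ fun s hs => ⟨s, le_rfl, hs, hB s hs⟩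
      · exact liminfBelow_eq_of_eventually ht (v := fun s => (run M p s).output ξ)
          ⟨s, h, fun r h1 h2 => (ih r h2 h1).2 ξ hξ⟩
    · simp

theorem outputHead_limit {t : Ordinal.{u}} (ht : IsSuccLimit t) {L : Ordinal.{u}}
    (h : ∀ s < t, (run M p s).outputHead ≤ L)
    (h' : ∀ a < L, ∃ s < t, a < (run M p s).outputHead) :
    (run M p t).outputHead = L := by
  rw [run_limit ht]
  refine liminfBelow_ordinal_eq ht (v := fun s => (run M p s).outputHead) (fun a ha => ?_)
    fun s hs => ⟨s, le_rfl, hs, h s hs⟩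
  obtain ⟨s, hs, has⟩ := h' a ha
  exact ⟨s, hs, fun r h1 h2 => has.trans_le (output_mono h1).1⟩

theorem HasWritten.output_eq {y z : GenCantor κ} {α α' s t : Ordinal.{u}}
    (hy : HasWritten (run M p s) α y) (hz : HasWritten (run M p t) α' z)
    {ξ : Set.Iio κ.ord} (h : ξ.1 < α) (h' : ξ.1 < α') : y ξ = z ξ := by
  rw [← hy.2 ξ h, ← hz.2 ξ h', ← (output_mono (le_max_left s t)).2 ξ (h.trans_le hy.1),
    ← (output_mono (le_max_right s t)).2 ξ (h'.trans_le hz.1)]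

end KappaTM

/-! ### The bounded topology in terms of initial segments. -/

namespace GenCantor

variable {κ : Cardinal.{u}}

theorem isOpen_agree (x : GenCantor κ) {α : Ordinal.{u}} (hα : α < κ.ord) :
    IsOpen {y : GenCantor κ | ∀ ξ : Set.Iio κ.ord, ξ.1 < α → y ξ = x ξ} := by
  refine TopologicalSpace.isOpen_generateFrom_of_mem
    ⟨α, hα, fun ξ => x ⟨ξ.1, lt_trans ξ.2 hα⟩, Set.ext fun y => ?_⟩
  exact ⟨fun h ξ => h _ ξ.2, fun h ξ hξ => h ⟨ξ.1, hξ⟩⟩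

theorem exists_agree_subset (hκ : Cardinal.aleph0 < κ) {U : Set (GenCantor κ)} (hU : IsOpen U)
    {x : GenCantor κ} (hx : x ∈ U) :
    ∃ α < κ.ord, {y : GenCantor κ | ∀ ξ : Set.Iio κ.ord, ξ.1 < α → y ξ = x ξ} ⊆ U := by
  induction hU with
  | basic s hs =>
    obtain ⟨α, hα, σ, rfl⟩ := hs
    exact ⟨α, hα, fun y hy ξ => (hy _ ξ.2).trans (hx ξ)⟩
  | univ => exact ⟨0, (Cardinal.isSuccLimit_ord hκ.le).bot_lt, Set.subset_univ _⟩
  | inter s t _ _ ihs iht =>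
    obtain ⟨α, hα, h⟩ := ihs hx.1
    obtain ⟨β, hβ, h'⟩ := iht hx.2
    exact ⟨max α β, max_lt hα hβ, fun y hy => ⟨h fun ξ hξ => hy ξ (lt_max_of_lt_left hξ),
      h' fun ξ hξ => hy ξ (lt_max_of_lt_right hξ)⟩⟩
  | sUnion S _ ih =>
    obtain ⟨s, hs, hxs⟩ := hx
    obtain ⟨α, hα, h⟩ := ih s hs hxs
    exact ⟨α, hα, h.trans (Set.subset_sUnion_of_mem hs)⟩

/-- Continuity of a partial function in terms of initial segments. -/
theorem partialContinuous_iff (hκ : Cardinal.aleph0 < κ) (f : GenCantor κ →. GenCantor κ) :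
    PartialContinuous f ↔ ∀ x (hx : x ∈ f.Dom), ∀ α < κ.ord, ∃ β < κ.ord,
      ∀ y (hy : y ∈ f.Dom), (∀ ξ : Set.Iio κ.ord, ξ.1 < β → y ξ = x ξ) →
        ∀ ξ : Set.Iio κ.ord, ξ.1 < α → f.fn y hy ξ = f.fn x hx ξ := by
  constructor
  · intro hf x hx α hα
    obtain ⟨U, hU, hUf⟩ := (isOpen_agree (f.fn x hx) hα).preimage hf
    have hxU : x ∈ U := by
      have : (⟨x, hx⟩ : f.Dom) ∈ Subtype.val ⁻¹' U := by
        rw [hUf]; intro ξ _; rfl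
      exact this
    obtain ⟨β, hβ, h⟩ := exists_agree_subset hκ hU hxU
    refine ⟨β, hβ, fun y hy hyx => ?_⟩
    have : (⟨y, hy⟩ : f.Dom) ∈ Subtype.val ⁻¹' U := h hyx
    rw [hUf] at this
    exact this
  · intro h
    refine continuous_generateFrom_iff.2 ?_
    rintro _ ⟨α, hα, σ, rfl⟩
    refine isOpen_iff_forall_mem_open.2 fun ⟨x, hx⟩ hxσ => ?_
    obtain ⟨β, hβ, h⟩ := h x hx α hα
    refine ⟨Subtype.val ⁻¹' _, ?_, (isOpen_agree x hβ).preimage continuous_subtype_val,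
      fun ξ _ => rfl⟩
    rintro ⟨y, hy⟩ hyx ξ
    exact (h y hy hyx ⟨ξ.1, _⟩ ξ.2).trans (hxσ ξ)

end GenCantor

/-! ### Computable functions are continuous. -/

namespace KappaTM

variable {κ : Cardinal.{u}}

theorem Computes.partialContinuous (hκ : Cardinal.aleph0 < κ) {M : OracleMachine}
    {o : GenCantor κ} {f : GenCantor κ →. GenCantor κ} (h : Computes M o f) :
    PartialContinuous f := by
  refine (GenCantor.partialContinuous_iff hκ f).2 fun x hx α hα => ?_
  obtain ⟨β, hβ, hw⟩ := h x hx α hα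
  refine ⟨β, hβ, fun y hy hyx ξ hξ => ?_⟩
  obtain ⟨β', hβ', hw'⟩ := h y hy α hα
  -- The time `β'` for `y` may exceed `β`; what is written by time `β` is still there.
  have hrun : run M ![x, o] β = run M ![y, o] β := by
    refine run_congr (β := β) (fun i ζ hζ => ?_) le_rfl
    fin_cases i
    · simp only [Tape.read]
      split_ifs with h0
      · exact (hyx ⟨ζ, h0⟩ hζ).symm
      · rfl
    · rfl
  rw [hrun] at hw
  exact hw'.output_eq hw hξ hξ

end KappaTM

/-! ### The record scanner. -/

namespace KappaTM

open Order

variable {κ : Cardinal.{u}}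

/-- Transition table of the record scanner: from the state, the input symbol and the oracle
symbol to the next state, the movement of the input head and the written symbol. In the states
`0, 1, 2, 3` the input has agreed with the current record so far, in the states `4, 5, 6, 7` it
has not, or the record has no output symbol. -/
def scanTable : Fin 8 → Bool → Bool → Fin 8 × Move × Option Bool
  -- States 0, 1 and 4, 5 alternate during the comparison, so the inferior limit is the even state
  -- of the pair. An oracle symbol 1 read in state 0 or 4 ends the word; moving left from a limit
  -- cell then resets the input head.
  | 0, _, b => if b then (2, .left, none) else (1, .stay, none)
  | 1, a, b => if a = b then (0, .right, none) else (4, .right, none)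
  | 2, _, b => if b then (3, .stay, none) else (7, .stay, none)
  | 3, _, b => (0, .stay, some b)
  | 4, _, b => if b then (6, .left, none) else (5, .stay, none)
  | 5, _, _ => (4, .right, none)
  -- States 6 and 7 idle over the two cells after the end marker, so a record takes equally long on
  -- every input.
  | 6, _, _ => (7, .stay, none)
  | 7, _, _ => (0, .stay, none)

/-- The record scanner. Its oracle head moves to the right in every step. -/
def scanner : OracleMachine where
  maxState := 7
  scratch := 0
  trans s a _ := some
    { next := (scanTable s (a 0) (a 1)).1
      inputMove := ![(scanTable s (a 0) (a 1)).2.1, .right]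
      scratchWrite := Fin.elim0
      scratchMove := Fin.elim0
      output := (scanTable s (a 0) (a 1)).2.2 }

section Block

variable {x o : Tape κ}

/-- This identifies oracle cells with times: cell `t` is scanned exactly at time `t`. -/
theorem scanner_oracleHead (t : Ordinal.{u}) : (run scanner ![x, o] t).inputHead 1 = t := by
  induction t using Ordinal.limitRecOn with
  | zero => rw [run_zero]; rfl
  | add_one t ih =>
    rw [run_add_one]
    exact congrArg (· + 1) ih
  | limit t ht ih =>
    rw [run_limit ht]
    refine liminfBelow_ordinal_eq ht (v := fun s => (run scanner ![x, o] s).inputHead 1)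
      (fun a ha => ⟨a + 1, ht.add_one_lt ha, fun r h1 h2 => ?_⟩)
      fun s hs => ⟨s, le_rfl, hs, by rw [ih s hs]; exact hs.le⟩
    rw [ih r h2]
    exact (lt_add_one a).trans_le h1

theorem scanner_add_one {t h l : Ordinal.{u}} {s : Fin 8}
    (hs : (run scanner ![x, o] t).state = s) (hh : (run scanner ![x, o] t).inputHead 0 = h)
    (hl : (run scanner ![x, o] t).outputHead = l) :
    (run scanner ![x, o] (t + 1)).state = (scanTable s (x.read h) (o.read t)).1 ∧
    (run scanner ![x, o] (t + 1)).inputHead 0 =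
      (scanTable s (x.read h) (o.read t)).2.1.apply h ∧
    (run scanner ![x, o] (t + 1)).outputHead =
      l + (if (scanTable s (x.read h) (o.read t)).2.2.isSome then 1 else 0) ∧
    ∀ b, (scanTable s (x.read h) (o.read t)).2.2 = some b → ∀ ξ : Set.Iio κ.ord, ξ.1 = l →
      (run scanner ![x, o] (t + 1)).output ξ = b := by
  have key : run scanner ![x, o] (t + 1) = perform
    { next := (scanTable s (x.read h) (o.read t)).1
      inputMove := ![(scanTable s (x.read h) (o.read t)).2.1, .right]
      scratchWrite := Fin.elim0
      scratchMove := Fin.elim0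
      output := (scanTable s (x.read h) (o.read t)).2.2 } (run scanner ![x, o] t) := by
    have := scanner_oracleHead (x := x) (o := o) t
    rw [run_add_one, step]
    simp only [scanner] at this hs hh ⊢
    simp [hs, hh, this]
  rw [key]
  refine ⟨rfl, by simp [perform, hh], ?_, ?_⟩
  · simp only [perform]
    cases (scanTable s (x.read h) (o.read t)).2.2 <;> simp [hl]
  · intro b hb ξ hξ
    simp [perform, hb, Tape.write, hl, hξ]

/-- The configuration of the scanner after it has compared `ξ` cells of a record, in terms of
the states for agreement and disagreement. -/
def Compared (x o : Tape κ) (z : Ordinal.{u} → Bool) (l ξ t : Ordinal.{u}) (a b : Fin 8) :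
    Prop :=
  (run scanner ![x, o] t).inputHead 0 = ξ ∧ (run scanner ![x, o] t).outputHead = l ∧
    ((∀ δ < ξ, x.read δ = z δ) → (run scanner ![x, o] t).state = a) ∧
    ((¬ ∀ δ < ξ, x.read δ = z δ) → (run scanner ![x, o] t).state = b)

theorem exists_eq_add_two_mul {S r ξ : Ordinal.{u}} (h : S ≤ r) (h' : r < S + 2 * ξ) :
    ∃ δ < ξ, r = S + 2 * δ ∨ r = S + 2 * δ + 1 := by
  obtain ⟨d, rfl⟩ := exists_add_of_le h
  have hd : d < 2 * ξ := lt_of_add_lt_add_left h'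
  refine ⟨d / 2, (Ordinal.lt_mul_iff_div_lt two_ne_zero).1 hd, ?_⟩
  have h1 := Ordinal.div_add_mod d 2
  have h2 : d % 2 ≤ 1 := Order.lt_add_one_iff.1 <| by
    rw [one_add_one_eq_two]; exact Ordinal.mod_lt d two_ne_zero
  rcases h2.lt_or_eq with h3 | h3
  · left; rw [Order.lt_one_iff.1 h3, add_zero] at h1; rw [h1]
  · right; rw [h3] at h1; rw [add_assoc, h1]

/-- Each input cell takes two steps. At a limit, state 0 has recurred cofinally if all cells agreed;
after a disagreement only 4 and 5 occur, and 4 recurs. -/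
theorem scanner_compare {z : Ordinal.{u} → Bool} {l S : Ordinal.{u}} {lam : Ordinal.{u}}
    (h0 : ∀ ξ < lam, o.read (S + 2 * ξ) = false)
    (h1 : ∀ ξ < lam, o.read (S + 2 * ξ + 1) = z ξ)
    (hs : (run scanner ![x, o] S).state = 0) (hh : (run scanner ![x, o] S).inputHead 0 = 0)
    (hl : (run scanner ![x, o] S).outputHead = l) (ξ : Ordinal.{u}) (hξ : ξ ≤ lam) :
    Compared x o z l ξ (S + 2 * ξ) 0 4 := by
  have odd : ∀ ξ < lam, Compared x o z l ξ (S + 2 * ξ) 0 4 →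
      Compared x o z l ξ (S + 2 * ξ + 1) 1 5 := by
    rintro ξ hξ ⟨hh, hl, ha, hb⟩
    by_cases hm : ∀ δ < ξ, x.read δ = z δ
    · obtain ⟨e1, e2, e3, -⟩ := scanner_add_one (ha hm) hh hl
      rw [h0 ξ hξ] at e1 e2 e3
      exact ⟨e2, by simpa [scanTable] using e3, fun _ => e1, fun h => absurd hm h⟩
    · obtain ⟨e1, e2, e3, -⟩ := scanner_add_one (hb hm) hh hl
      rw [h0 ξ hξ] at e1 e2 e3
      exact ⟨e2, by simpa [scanTable] using e3, fun h => absurd h hm, fun _ => e1⟩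
  induction ξ using Ordinal.limitRecOn with
  | zero =>
    rw [mul_zero, add_zero]
    exact ⟨hh, hl, fun _ => hs, fun h => absurd (fun δ hδ => absurd hδ not_lt_zero) h⟩
  | add_one ξ ih =>
    have hξ' : ξ < lam := Order.add_one_le_iff.1 hξ
    obtain ⟨hh, hl, ha, hb⟩ := odd ξ hξ' (ih hξ'.le)
    have ht : S + 2 * (ξ + 1) = S + 2 * ξ + 1 + 1 := by
      rw [mul_add, mul_one, add_assoc, add_assoc, one_add_one_eq_two]
    rw [ht]
    by_cases hm : ∀ δ < ξ, x.read δ = z δ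
    · obtain ⟨e1, e2, e3, -⟩ := scanner_add_one (ha hm) hh hl
      rw [h1 ξ hξ'] at e1 e2 e3
      by_cases hx : x.read ξ = z ξ
      · simp only [scanTable, if_pos hx] at e1 e2 e3
        refine ⟨e2, by simpa using e3, fun _ => e1, fun h => absurd (fun δ hδ => ?_) h⟩
        rcases (Order.lt_add_one_iff.1 hδ).lt_or_eq with h | rfl
        exacts [hm δ h, hx]
      · simp only [scanTable, if_neg hx] at e1 e2 e3
        exact ⟨e2, by simpa using e3, fun h => absurd (h ξ (lt_add_one ξ)) hx, fun _ => e1⟩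
    · obtain ⟨e1, e2, e3, -⟩ := scanner_add_one (hb hm) hh hl
      exact ⟨e2, by simpa [scanTable] using e3,
        fun h => absurd (fun δ hδ => h δ (hδ.trans (lt_add_one ξ))) hm, fun _ => e1⟩
  | limit ξ hlim ih =>
    have hpos : (0 : Ordinal.{u}) < 2 := two_pos
    have hmul : ∀ {δ}, δ < ξ → S + 2 * δ < S + 2 * ξ := fun h => by
      gcongr
    have ht : IsSuccLimit (S + 2 * ξ) :=
      Ordinal.isSuccLimit_add S (Ordinal.isSuccLimit_mul_right hpos hlim)
    have cases : ∀ r, S ≤ r → r < S + 2 * ξ → ∃ δ < ξ, r < S + 2 * (δ + 1) ∧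
        (Compared x o z l δ r 0 4 ∨ Compared x o z l δ r 1 5) := by
      intro r hr hr'
      obtain ⟨δ, hδ, h⟩ := exists_eq_add_two_mul hr hr'
      have hc := ih δ hδ (hδ.le.trans hξ)
      have e : S + 2 * (δ + 1) = S + 2 * δ + 1 + 1 := by
        rw [mul_add, mul_one, add_assoc, add_assoc, one_add_one_eq_two]
      refine ⟨δ, hδ, ?_, ?_⟩
      · rcases h with rfl | rfl
        · gcongr; exact lt_add_one δ
        · rw [e]; exact lt_add_one _
      · rcases h with rfl | rfl
        exacts [.inl hc, .inr (odd δ (hδ.trans_le hξ) hc)]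
    -- `cof` yields the cofinal upper bounds for the inferior limits, `late` the eventual lower
    -- bounds.
    have cof : ∀ s < S + 2 * ξ, ∀ δ₀ < ξ, ∃ δ, δ₀ ≤ δ ∧ δ < ξ ∧ s ≤ S + 2 * δ := by
      intro s hs δ₀ hδ₀
      rcases le_or_gt S s with h | h
      · obtain ⟨δ, hδ, h, -⟩ := cases s h hs
        exact ⟨max δ₀ (δ + 1), le_max_left _ _, max_lt hδ₀ (hlim.add_one_lt hδ),
          h.le.trans (by gcongr; exact le_max_right _ _)⟩
      · exact ⟨δ₀, le_rfl, hδ₀, h.le.trans le_self_add⟩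
    have late : ∀ {δ₀}, δ₀ < ξ → ∀ r, S + 2 * δ₀ ≤ r → r < S + 2 * ξ → ∃ δ < ξ, δ₀ ≤ δ ∧
        (Compared x o z l δ r 0 4 ∨ Compared x o z l δ r 1 5) := by
      intro δ₀ hδ₀ r h h'
      obtain ⟨δ, hδ, h2, h3⟩ := cases r (le_self_add.trans h) h'
      refine ⟨δ, hδ, Order.lt_add_one_iff.1 ?_, h3⟩
      exact lt_of_mul_lt_mul_left (lt_of_add_lt_add_left (h.trans_lt h2)) hpos.le
    refine ⟨?_, ?_, fun hm => ?_, fun hm => ?_⟩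
    · rw [run_limit ht]
      refine liminfBelow_ordinal_eq ht (v := fun s => (run scanner ![x, o] s).inputHead 0)
        (fun a ha => ⟨_, hmul (hlim.add_one_lt ha), fun r h h' => ?_⟩) fun s hs => ?_
      · obtain ⟨δ, -, h2, h3⟩ := late (hlim.add_one_lt ha) r h h'
        have : (run scanner ![x, o] r).inputHead 0 = δ := h3.elim (·.1) (·.1)
        rw [this]
        exact (lt_add_one a).trans_le h2
      · obtain ⟨δ, -, hδ, h⟩ := cof s hs 0 hlim.bot_lt
        exact ⟨_, h, hmul hδ, (ih δ hδ (hδ.le.trans hξ)).1.trans_le hδ.le⟩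
    · rw [run_limit ht]
      refine liminfBelow_eq_of_eventually ht
        (v := fun s => (run scanner ![x, o] s).outputHead)
        ⟨_, hmul hlim.bot_lt, fun r h h' => ?_⟩
      obtain ⟨δ, -, -, h3⟩ := late hlim.bot_lt r h h'
      exact h3.elim (·.2.1) (·.2.1)
    · rw [run_limit ht]
      refine liminfBelow_eq_bot ht (β := Fin 8) (v := fun s => (run scanner ![x, o] s).state)
        fun s hs => ?_
      obtain ⟨δ, -, hδ, h⟩ := cof s hs 0 hlim.bot_lt
      exact ⟨_, h, hmul hδ, (ih δ hδ (hδ.le.trans hξ)).2.2.1 fun ε hε => hm ε (hε.trans hδ)⟩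
    · rw [run_limit ht]
      push Not at hm
      obtain ⟨ε, hε, hne⟩ := hm
      have hbad : ∀ δ, ε + 1 ≤ δ → ¬ ∀ ε' < δ, x.read ε' = z ε' := fun δ hδ h =>
        hne (h ε (Order.add_one_le_iff.1 hδ))
      refine liminfBelow_eq ht (β := Fin 8) (v := fun s => (run scanner ![x, o] s).state)
        ⟨_, hmul (hlim.add_one_lt hε), fun r h h' => ?_⟩ fun s hs => ?_
      · obtain ⟨δ, -, h2, h3⟩ := late (hlim.add_one_lt hε) r h h'
        rcases h3 with h3 | h3
        · exact (h3.2.2.2 (hbad δ h2)).ge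
        · rw [h3.2.2.2 (hbad δ h2)]
          decide
      · obtain ⟨δ, h1, hδ, h⟩ := cof s hs _ (hlim.add_one_lt hε)
        exact ⟨_, h, hmul hδ, ((ih δ hδ (hδ.le.trans hξ)).2.2.2 (hbad δ h1)).le⟩

/-- A limit is a left multiple of `ω`, and `2 * ω = ω`. Hence the end marker of a record stands at
offset `size`. -/
theorem two_mul_of_isSuccLimit {lam : Ordinal.{u}} (h : IsSuccLimit lam) : 2 * lam = lam := by
  exact_mod_cast Ordinal.mul_omega0_dvd (a := (2 : ℕ)) (by simp) (Ordinal.natCast_lt_omega0 _)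
    (Ordinal.isSuccPrelimit_iff_omega0_dvd.1 h.isSuccPrelimit)

theorem Move.left_apply_of_isSuccLimit {h : Ordinal.{u}} (hh : IsSuccLimit h) :
    Move.left.apply h = 0 := by
  rw [Move.apply, if_neg]
  rintro ⟨a, rfl⟩
  exact Order.not_isSuccLimit_add_one a hh

/-- What the scanner does while it reads a record. -/
theorem scanner_record {z : Ordinal.{u} → Bool} {b : Option Bool} {l S lam : Ordinal.{u}}
    (hlam : IsSuccLimit lam)
    (h0 : ∀ ξ < lam, o.read (S + 2 * ξ) = false)
    (h1 : ∀ ξ < lam, o.read (S + 2 * ξ + 1) = z ξ)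
    (h2 : o.read (S + lam) = true) (h3 : o.read (S + lam + 1) = b.isSome)
    (h4 : o.read (S + lam + 1 + 1) = b.getD false)
    (hs : (run scanner ![x, o] S).state = 0) (hh : (run scanner ![x, o] S).inputHead 0 = 0)
    (hl : (run scanner ![x, o] S).outputHead = l) :
    (run scanner ![x, o] (S + lam + 1 + 1 + 1)).state = 0 ∧
    (run scanner ![x, o] (S + lam + 1 + 1 + 1)).inputHead 0 = 0 ∧
    (((∀ ξ < lam, x.read ξ = z ξ) ∧ b.isSome) →
      (run scanner ![x, o] (S + lam + 1 + 1 + 1)).outputHead = l + 1 ∧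
      ∀ ξ : Set.Iio κ.ord, ξ.1 = l →
        (run scanner ![x, o] (S + lam + 1 + 1 + 1)).output ξ = b.getD false) ∧
    (¬ ((∀ ξ < lam, x.read ξ = z ξ) ∧ b.isSome) →
      (run scanner ![x, o] (S + lam + 1 + 1 + 1)).outputHead = l) := by
  obtain ⟨ch, cl, ca, cb⟩ := scanner_compare h0 h1 hs hh hl lam le_rfl
  rw [two_mul_of_isSuccLimit hlam] at ch cl ca cb
  by_cases hm : ∀ δ < lam, x.read δ = z δ
  · obtain ⟨s1, i1, l1, -⟩ := scanner_add_one (ca hm) ch cl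
    simp only [h2, scanTable, if_true, Option.isSome_none, Bool.false_eq_true, if_false,
      add_zero, Move.left_apply_of_isSuccLimit hlam] at s1 i1 l1
    obtain ⟨s2, i2, l2, -⟩ := scanner_add_one s1 i1 l1
    cases b with
    | none =>
      simp only [h3, scanTable, Option.isSome_none, Bool.false_eq_true, if_false,
        add_zero, Move.apply] at s2 i2 l2
      obtain ⟨s3, i3, l3, -⟩ := scanner_add_one s2 i2 l2
      exact ⟨s3, i3, by simp, fun _ => by simpa [scanTable] using l3⟩
    | some b =>
      simp only [h3, scanTable, Option.isSome_none, Option.isSome_some, Bool.false_eq_true,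
        if_false, if_true, add_zero, Move.apply] at s2 i2 l2
      obtain ⟨s3, i3, l3, o3⟩ := scanner_add_one s2 i2 l2
      rw [h4] at o3
      refine ⟨s3, i3, fun _ => ⟨by simpa [scanTable] using l3, o3 _ rfl⟩,
        fun h => absurd ⟨hm, rfl⟩ h⟩
  · obtain ⟨s1, i1, l1, -⟩ := scanner_add_one (cb hm) ch cl
    simp only [h2, scanTable, if_true, Option.isSome_none, Bool.false_eq_true, if_false,
      add_zero, Move.left_apply_of_isSuccLimit hlam] at s1 i1 l1
    obtain ⟨s2, i2, l2, -⟩ := scanner_add_one s1 i1 l1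
    simp only [scanTable, Option.isSome_none, Bool.false_eq_true, if_false,
        add_zero, Move.apply] at s2 i2 l2
    obtain ⟨s3, i3, l3, -⟩ := scanner_add_one s2 i2 l2
    exact ⟨s3, i3, fun h => absurd h.1 hm, fun _ => by simpa [scanTable] using l3⟩

end Block

end KappaTM

/-! ### Records on the oracle tape. -/

namespace KappaTM

open Order

section Accumulate

variable {X : Type*} (g : Ordinal.{u} → (X → Ordinal.{u}) → X → Ordinal.{u})

/-- The transfinite iteration of `g`, starting from `0` and continuous at limits. -/
noncomputable def accumulate (i : Ordinal.{u}) : X → Ordinal.{u} :=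
  Ordinal.limitRecOn i (fun _ => 0) g fun i _ F x => ⨆ j : Set.Iio i, F j.1 j.2 x

variable {g}

theorem accumulate_zero (x : X) : accumulate g 0 x = 0 := by
  rw [accumulate, Ordinal.limitRecOn_zero]

theorem accumulate_add_one (i : Ordinal.{u}) (x : X) :
    accumulate g (i + 1) x = g i (accumulate g i) x :=
  congrFun (Ordinal.limitRecOn_add_one ..) x

theorem lt_accumulate_limit {i : Ordinal.{u}} (hi : IsSuccLimit i) {a : Ordinal.{u}} {x : X} :
    a < accumulate g i x ↔ ∃ j < i, a < accumulate g j x := by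
  have : accumulate g i x = ⨆ j : Set.Iio i, accumulate g j x := by
    rw [accumulate, Ordinal.limitRecOn_limit _ _ _ _ hi]; rfl
  rw [this, Ordinal.lt_iSup_iff]
  simp

theorem accumulate_mono (hg : ∀ i F x, F x ≤ g i F x) {i j : Ordinal.{u}} (hij : i ≤ j) (x : X) :
    accumulate g i x ≤ accumulate g j x := by
  induction j using Ordinal.limitRecOn with
  | zero => obtain rfl : i = 0 := by simpa using hij
            exact le_rfl
  | add_one j ih =>
    rcases hij.lt_or_eq with h | rfl
    · rw [accumulate_add_one]
      exact (ih (Order.lt_add_one_iff.1 h)).trans (hg _ _ _)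
    · exact le_rfl
  | limit j hj ih =>
    rcases hij.lt_or_eq with h | rfl
    · exact le_of_forall_lt fun a ha => (lt_accumulate_limit hj).2 ⟨i, h, ha⟩
    · exact le_rfl

end Accumulate

/-- A record on the oracle tape: if the input starts with the first `size` symbols of `word`,
then `out` is to be written. -/
structure Record where
  /-- the length of the initial segment of the input that is tested -/
  size : Ordinal.{u}
  /-- the symbols for which the input is tested -/
  word : Ordinal.{u} → Bool
  /-- the symbol to be written -/
  out : Option Bool

/-- The cells of the oracle tape that represent a record. -/
noncomputable def Record.symbol (r : Record.{u}) (s : Ordinal.{u}) : Bool :=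
  open Classical in
  -- Inside the word, an even offset holds 0, meaning that the word goes on, and the next odd offset
  -- holds its symbol.
  if s < r.size then (if s % 2 = 0 then false else r.word (s / 2))
  else if s = r.size then true else if s = r.size + 1 then r.out.isSome else r.out.getD false

/-- The cell of the oracle tape in which a record starts. -/
noncomputable def recordStart (R : Ordinal.{u} → Record.{u}) (i : Ordinal.{u}) : Ordinal.{u} :=
  accumulate (X := Unit) (fun i F u => F u + (R i).size + 1 + 1 + 1) i ()

open Classical in
/-- The concatenation of a sequence of records. -/
noncomputable def recordTape (κ : Cardinal.{u}) (R : Ordinal.{u} → Record.{u}) : GenCantor κ :=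
  fun t => decide (∃ i s, s < (R i).size + 1 + 1 + 1 ∧ t.1 = recordStart R i + s ∧
    (R i).symbol s = true)

variable {κ : Cardinal.{u}} {R : Ordinal.{u} → Record.{u}}

theorem recordStart_add_one (i : Ordinal.{u}) :
    recordStart R (i + 1) = recordStart R i + (R i).size + 1 + 1 + 1 :=
  accumulate_add_one i ()

theorem recordStart_mono {i j : Ordinal.{u}} (h : i ≤ j) : recordStart R i ≤ recordStart R j :=
  accumulate_mono (fun _ _ _ => by simp only [add_assoc]; exact le_self_add) h ()

theorem recordStart_strictMono : StrictMono (recordStart R) := fun i j h =>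
  calc recordStart R i < recordStart R (i + 1) := by
        rw [recordStart_add_one, Order.lt_add_one_iff]
        simp only [add_assoc]; exact le_self_add
    _ ≤ recordStart R j := recordStart_mono (Order.add_one_le_of_lt h)

theorem isSuccLimit_recordStart {i : Ordinal.{u}} (hi : IsSuccLimit i) :
    IsSuccLimit (recordStart R i) := by
  refine Ordinal.isSuccLimit_iff.2 ⟨(hi.bot_lt.trans_le recordStart_strictMono.le_apply).ne', ?_⟩
  refine isSuccPrelimit_of_succ_lt fun a ha => ?_
  obtain ⟨j, hj, h⟩ := (lt_accumulate_limit hi).1 ha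
  exact (Order.succ_le_of_lt h).trans_lt (recordStart_strictMono hj)

/-- Distinct records occupy disjoint intervals, so a cell determines its record and offset. -/
theorem read_recordTape {i s : Ordinal.{u}} (hs : s < (R i).size + 1 + 1 + 1)
    (hκ : recordStart R (i + 1) ≤ κ.ord) :
    Tape.read (recordTape κ R) (recordStart R i + s) = (R i).symbol s := by
  classical
  have hend : ∀ {j s : Ordinal.{u}}, s < (R j).size + 1 + 1 + 1 →
      recordStart R j + s < recordStart R (j + 1) := fun h => by
    rw [recordStart_add_one]
    simp only [add_assoc] at h ⊢
    gcongr
  have hlt : recordStart R i + s < κ.ord := (hend hs).trans_le hκ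
  refine (dif_pos hlt).trans (Bool.eq_iff_iff.2 ?_)
  rw [recordTape, decide_eq_true_iff]
  constructor
  · rintro ⟨j, s', hs', he, h⟩
    rcases lt_trichotomy i j with hij | rfl | hij
    · refine absurd he (ne_of_lt ?_)
      exact ((hend hs).trans_le (recordStart_mono (Order.add_one_le_of_lt hij))).trans_le
        le_self_add
    · rwa [add_left_cancel he]
    · refine absurd he (ne_of_gt ?_)
      exact ((hend hs').trans_le (recordStart_mono (Order.add_one_le_of_lt hij))).trans_le
        le_self_add
  · exact fun h => ⟨i, s, hs, rfl, h⟩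

theorem Record.symbol_two_mul (r : Record.{u}) {ξ : Ordinal.{u}} (h : 2 * ξ < r.size) :
    r.symbol (2 * ξ) = false := by
  rw [Record.symbol, if_pos h, if_pos (Ordinal.mul_mod _ _)]

theorem Record.symbol_two_mul_add_one (r : Record.{u}) {ξ : Ordinal.{u}}
    (h : 2 * ξ + 1 < r.size) : r.symbol (2 * ξ + 1) = r.word ξ := by
  have h12 : (1 : Ordinal.{u}) < 2 := one_lt_two
  rw [Record.symbol, if_pos h, Ordinal.mul_add_mod_self, Ordinal.mod_eq_of_lt h12,
    if_neg one_ne_zero, Ordinal.mul_add_div _ two_ne_zero, Ordinal.div_eq_zero_of_lt h12, add_zero]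

/-- If the records in the sequence `R` for the initial segments of `x` list the symbols of `y`,
then the record scanner writes `y`; here `L i` is the number of symbols listed before the record
with the number `i`. -/
theorem scanner_writes (hR : ∀ i, IsSuccLimit (R i).size)
    (hstart : ∀ i < κ.ord, recordStart R i < κ.ord)
    {x y : GenCantor κ} {L : Ordinal.{u} → Ordinal.{u}} (L_zero : L 0 = 0)
    (L_pos : ∀ i < κ.ord, (∀ ξ < (R i).size, Tape.read x ξ = (R i).word ξ) → (R i).out.isSome →
      L (i + 1) = L i + 1)
    (L_neg : ∀ i < κ.ord, ¬ ((∀ ξ < (R i).size, Tape.read x ξ = (R i).word ξ) ∧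
      (R i).out.isSome) → L (i + 1) = L i)
    (L_limit : ∀ i < κ.ord, IsSuccLimit i → ∀ a, a < L i ↔ ∃ j < i, a < L j)
    (correct : ∀ i < κ.ord, (∀ ξ < (R i).size, Tape.read x ξ = (R i).word ξ) →
      ∀ b, (R i).out = some b → ∀ ξ : Set.Iio κ.ord, ξ.1 = L i → y ξ = b)
    (unbounded : ∀ α < κ.ord, ∃ i < κ.ord, α ≤ L i) :
    Writes scanner ![x, recordTape κ R] y := by
  set c := run scanner ![x, recordTape κ R] with hc
  have main : ∀ i < κ.ord, (c (recordStart R i)).state = (0 : Fin 8) ∧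
      (c (recordStart R i)).inputHead 0 = 0 ∧ (c (recordStart R i)).outputHead = L i ∧
      ∀ ξ : Set.Iio κ.ord, ξ.1 < L i → (c (recordStart R i)).output ξ = y ξ := by
    intro i hi
    induction i using Ordinal.limitRecOn with
    | zero =>
      have h0 : recordStart R 0 = 0 := accumulate_zero _
      rw [h0, hc, run_zero, L_zero]
      exact ⟨rfl, rfl, rfl, fun ξ hξ => absurd hξ not_lt_zero⟩
    | add_one i ih =>
      have hi' : i < κ.ord := (lt_add_one i).trans hi
      obtain ⟨hs, hh, hl, ho⟩ := ih hi'
      have read : ∀ s < (R i).size + 1 + 1 + 1,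
          Tape.read (recordTape κ R) (recordStart R i + s) = (R i).symbol s :=
        fun s h => read_recordTape h (hstart _ hi).le
      have lt1 := lt_add_one (R i).size
      have lt2 := lt_add_one ((R i).size + 1)
      have lt3 := lt_add_one ((R i).size + 1 + 1)
      have two : ∀ ξ < (R i).size, 2 * ξ < (R i).size := fun ξ h => by
        calc 2 * ξ < 2 * (R i).size := by gcongr
          _ = _ := two_mul_of_isSuccLimit (hR i)
      have far := lt1.trans (lt2.trans lt3)
      obtain ⟨hs', hh', hp, hn⟩ := scanner_record (z := (R i).word) (b := (R i).out)
        (x := x) (o := recordTape κ R) (hR i)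
        (fun ξ hξ => by
          rw [read _ ((two ξ hξ).trans far), Record.symbol_two_mul _ (two ξ hξ)])
        (fun ξ hξ => by
          have := (hR i).add_one_lt (two ξ hξ)
          rw [add_assoc, read _ (this.trans far), Record.symbol_two_mul_add_one _ this])
        (by rw [read _ far]; simp [Record.symbol])
        (by
          rw [add_assoc, read _ (lt2.trans lt3), Record.symbol, if_neg lt1.not_gt,
            if_neg lt1.ne', if_pos rfl])
        (by
          rw [add_assoc, add_assoc, ← add_assoc _ 1 1, read _ lt3, Record.symbol,
            if_neg (lt1.trans lt2).not_gt, if_neg (lt1.trans lt2).ne', if_neg lt2.ne'])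
        hs hh hl
      rw [← recordStart_add_one] at hs' hh' hp hn
      have old := (output_mono (M := scanner) (p := ![x, recordTape κ R])
        (recordStart_mono (R := R) (le_self_add : i ≤ i + 1))).2
      by_cases hb : (∀ ξ < (R i).size, Tape.read x ξ = (R i).word ξ) ∧ (R i).out.isSome
      · rw [L_pos i hi' hb.1 hb.2]
        refine ⟨hs', hh', (hp hb).1, fun ξ hξ => ?_⟩
        rcases (Order.lt_add_one_iff.1 hξ).lt_or_eq with h | h
        · exact (old ξ (h.trans_eq hl.symm)).trans (ho ξ h)
        · obtain ⟨b, hb'⟩ := Option.isSome_iff_exists.1 hb.2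
          rw [correct i hi' hb.1 b hb' ξ h]
          refine ((hp hb).2 ξ h).trans ?_
          rw [hb']; rfl
      · rw [L_neg i hi' hb]
        exact ⟨hs', hh', hn hb, fun ξ h => (old ξ (h.trans_eq hl.symm)).trans (ho ξ h)⟩
    | limit i hlim ih =>
      -- At a limit of records, state 0 and input position 0 recur at the earlier record starts, so
      -- both inferior limits are 0.
      have ht := isSuccLimit_recordStart (R := R) hlim
      have cof : ∀ s < recordStart R i, ∃ j < i, s ≤ recordStart R j := fun s hs =>
        ((lt_accumulate_limit hlim).1 hs).imp fun _ h => ⟨h.1, h.2.le⟩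
      have hl : (c (recordStart R i)).outputHead = L i := by
        refine outputHead_limit ht (fun s hs => ?_) fun a ha => ?_
        · obtain ⟨j, hj, hsj⟩ := cof s hs
          refine (output_mono hsj).1.trans ((ih j hj (hj.trans hi)).2.2.1.trans_le ?_)
          exact le_of_forall_lt fun a ha => (L_limit i hi hlim a).2 ⟨j, hj, ha⟩
        · obtain ⟨j, hj, h⟩ := (L_limit i hi hlim a).1 ha
          exact ⟨_, recordStart_strictMono hj, h.trans_eq (ih j hj (hj.trans hi)).2.2.1.symm⟩
      refine ⟨?_, ?_, hl, fun ξ hξ => ?_⟩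
      · rw [hc, run_limit ht]
        refine liminfBelow_eq_bot ht (β := Fin 8) (v := fun s => (c s).state) fun s hs => ?_
        obtain ⟨j, hj, h⟩ := cof s hs
        exact ⟨_, h, recordStart_strictMono hj, (ih j hj (hj.trans hi)).1⟩
      · rw [hc, run_limit ht]
        refine liminfBelow_eq_bot ht (v := fun s => (c s).inputHead 0) fun s hs => ?_
        obtain ⟨j, hj, h⟩ := cof s hs
        exact ⟨_, h, recordStart_strictMono hj, (ih j hj (hj.trans hi)).2.1⟩
      · obtain ⟨j, hj, h⟩ := (L_limit i hi hlim _).1 hξ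
        obtain ⟨-, -, hlj, ho⟩ := ih j hj (hj.trans hi)
        exact ((output_mono (recordStart_mono hj.le)).2 ξ (h.trans_eq hlj.symm)).trans (ho ξ h)
  intro α hα
  obtain ⟨i, hi, hαi⟩ := unbounded α hα
  obtain ⟨-, -, hl, ho⟩ := main i hi
  exact ⟨_, hstart i hi, hαi.trans_eq hl.symm, fun ξ hξ => ho ξ (hξ.trans_le hαi)⟩

end KappaTM

/-! ### Consequences of `κ ^ (<κ) = κ`. -/

section Cardinals

open Order Cardinal

variable {κ : Cardinal.{u}}

/-- By König, `κ` is less than `κ` to the power of its cofinality. -/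
theorem Cardinal.isRegular_of_powerlt_eq (hκ : ℵ₀ ≤ κ) (hpow : powerlt κ κ = κ) :
    κ.IsRegular := by
  refine ⟨hκ, le_of_not_gt fun h => ?_⟩
  exact ((lt_power_cof_ord hκ).trans_le (le_powerlt κ h)).ne' hpow

theorem Cardinal.two_power_le_of_powerlt_eq (hκ : ℵ₀ ≤ κ) (hpow : powerlt κ κ = κ)
    {c : Cardinal.{u}} (hc : c < κ) : 2 ^ c ≤ κ :=
  (power_le_power_right ((natCast_lt_aleph0 (n := 2)).le.trans hκ)).trans
    ((le_powerlt κ hc).trans_eq hpow)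

theorem Cardinal.IsRegular.exists_bound_of_lt_ord (hκ : κ.IsRegular) {γ : Ordinal.{u}}
    (hγ : γ < κ.ord) {F : Ordinal.{u} → Ordinal.{u}} (hF : ∀ δ < γ, F δ < κ.ord) :
    ∃ B < κ.ord, ∀ δ < γ, F δ < B := by
  refine ⟨⨆ i : γ.ToType, F (Ordinal.ToType.mk.symm i) + 1,
    Ordinal.iSup_add_one_lt_of_lt_cof ?_ fun i => hF _ (Ordinal.ToType.mk.symm i).2,
    fun δ hδ => ?_⟩
  · rw [hκ.cof_ord, mk_toType]
    exact lt_ord.1 hγ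
  · refine (lt_add_one _).trans_le ?_
    have := Ordinal.le_iSup (fun i : γ.ToType => F (Ordinal.ToType.mk.symm i) + 1)
      (Ordinal.ToType.mk ⟨δ, hδ⟩)
    simpa using this

theorem Ordinal.omega0_mul_add_one_lt_ord (hκ : ℵ₀ < κ) {γ : Ordinal.{u}} (hγ : γ < κ.ord) :
    Ordinal.omega0 * (γ + 1) < κ.ord :=
  isPrincipal_mul_ord hκ.le (omega0_lt_ord.2 hκ) ((isSuccLimit_ord hκ.le).add_one_lt hγ)

/-- If `κ ^ (<κ) = κ`, then there is an enumeration of length `κ` of the binary sequences whose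
length is of the form `ω * (γ + 1) < κ`, in which each of them occurs cofinally often. -/
theorem exists_cofinal_enumeration (hκ : ℵ₀ < κ) (hpow : powerlt κ κ = κ) :
    ∃ (len : Ordinal.{u} → Ordinal.{u}) (word : Ordinal.{u} → Ordinal.{u} → Bool),
      (∀ i, len i < κ.ord) ∧ ∀ γ < κ.ord, ∀ w : Ordinal.{u} → Bool, ∀ j < κ.ord,
        ∃ i, j ≤ i ∧ i < κ.ord ∧ len i = γ ∧ ∀ ξ < Ordinal.omega0 * (γ + 1), word i ξ = w ξ := by
  classical
  let A : Type (u + 1) := Set.Iio κ.ord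
  let S : Type (u + 1) := Σ γ : A, (Set.Iio (Ordinal.omega0 * (γ.1 + 1)) → Bool)
  let X : Type (u + 1) := S × A
  have hA : #A = lift.{u + 1} κ := by rw [Cardinal.mk_Iio_ordinal, card_ord]
  have hinf : ℵ₀ ≤ lift.{u + 1} κ := by simpa using hκ.le
  have hS : #S ≤ #A := by
    rw [mk_sigma]
    refine (sum_le_sum _ (fun _ => lift.{u + 1} κ) fun γ => ?_).trans ?_
    · have h2 := two_power_le_of_powerlt_eq hκ.le hpow
        (lt_ord.1 (Ordinal.omega0_mul_add_one_lt_ord hκ γ.2))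
      have h3 := lift_le.{u + 1}.2 h2
      rw [lift_power, lift_two] at h3
      simpa [Cardinal.mk_Iio_ordinal] using h3
    · rw [sum_const', hA, mul_eq_self hinf]
  have hX : #X ≤ #A := by
    rw [mk_prod, lift_id, lift_id]
    refine (mul_le_mul_left hS _).trans ?_
    rw [hA, mul_eq_self hinf]
  obtain ⟨e⟩ := (Cardinal.le_def X A).1 hX
  have hpos : (0 : Ordinal.{u}) < κ.ord := (isSuccLimit_ord hκ.le).bot_lt
  have : Nonempty X := ⟨⟨⟨⟨0, hpos⟩, fun _ => false⟩, ⟨0, hpos⟩⟩⟩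
  let inv : Ordinal.{u} → X := fun i =>
    if h : i < κ.ord then Function.invFun e ⟨i, h⟩ else Classical.arbitrary X
  have hinv : ∀ q, inv (e q).1 = q := fun q => by
    have : (e q).1 < κ.ord := (e q).2
    simp only [inv, dif_pos this]
    exact Function.leftInverse_invFun e.injective q
  refine ⟨fun i => (inv i).1.1.1, fun i ξ =>
    if h : ξ < Ordinal.omega0 * ((inv i).1.1.1 + 1) then (inv i).1.2 ⟨ξ, h⟩ else false,
    fun i => (inv i).1.1.2, fun γ hγ w j hj => ?_⟩
  -- These are `κ` many labelled copies of one sequence; they cannot all be numbered below `j <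
  -- κ.ord`.
  let q : A → X := fun a => ⟨⟨⟨γ, hγ⟩, fun ξ => w ξ⟩, a⟩
  have hq : ∃ a, j ≤ (e (q a)).1 := by
    by_contra! hall
    have hinj : Function.Injective fun a : A => (⟨(e (q a)).1, hall a⟩ : Set.Iio j) := by
      intro a b hab
      have : e (q a) = e (q b) := Subtype.ext (Subtype.mk.inj hab)
      exact congrArg Prod.snd (e.injective this)
    have := mk_le_of_injective hinj
    rw [hA, Cardinal.mk_Iio_ordinal, lift_le] at this
    exact this.not_gt (lt_ord.1 hj)
  obtain ⟨a, ha⟩ := hq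
  refine ⟨_, ha, (e (q a)).2, ?_, fun ξ hξ => ?_⟩
  · exact congrArg (fun q : X => q.1.1.1) (hinv (q a))
  · have hw : ∀ r : X, r = q a → (if h : ξ < Ordinal.omega0 * (r.1.1.1 + 1) then r.1.2 ⟨ξ, h⟩
        else false) = w ξ := by
      rintro _ rfl
      exact dif_pos hξ
    exact hw _ (hinv (q a))

end Cardinals

/-! ### The record chosen for each initial segment. -/

section FirstIndex

open Ordinal

variable (len : Ordinal.{u} → Ordinal.{u}) (word : Ordinal.{u} → Ordinal.{u} → Bool)

/-- The least index at which an enumeration lists the initial segment of length `ω * (γ + 1)` of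
`w`, among those above the indices chosen for the shorter initial segments. -/
noncomputable def firstIndex (w : Ordinal.{u} → Bool) (γ : Ordinal.{u}) : Ordinal.{u} :=
  sInf {i | len i = γ ∧ (∀ ξ < ω * (γ + 1), word i ξ = w ξ) ∧
    ∀ δ (_ : δ < γ), firstIndex w δ < i}
termination_by γ

variable {len word}

theorem firstIndex_congr {w w' : Ordinal.{u} → Bool} {γ : Ordinal.{u}}
    (h : ∀ ξ < ω * (γ + 1), w ξ = w' ξ) :
    firstIndex len word w γ = firstIndex len word w' γ := by
  induction γ using WellFoundedLT.induction with
  | ind γ ih =>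
    rw [firstIndex, firstIndex]
    congr 1
    ext i
    refine and_congr Iff.rfl (and_congr (forall₂_congr fun ξ hξ => by rw [h ξ hξ])
      (forall₂_congr fun δ hδ => ?_))
    rw [ih δ hδ fun ξ hξ => h ξ (hξ.trans_le (by gcongr))]

/-- Regularity bounds the earlier choices by some `B < κ.ord`, and the segment occurs again from `B`
on; so the infimum is attained. -/
theorem firstIndex_spec {κ : Cardinal.{u}} (hκ : κ.IsRegular)
    (henum : ∀ γ < κ.ord, ∀ w : Ordinal.{u} → Bool, ∀ j < κ.ord,
      ∃ i, j ≤ i ∧ i < κ.ord ∧ len i = γ ∧ ∀ ξ < ω * (γ + 1), word i ξ = w ξ)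
    (w : Ordinal.{u} → Bool) {γ : Ordinal.{u}} (hγ : γ < κ.ord) :
    firstIndex len word w γ < κ.ord ∧ len (firstIndex len word w γ) = γ ∧
      (∀ ξ < ω * (γ + 1), word (firstIndex len word w γ) ξ = w ξ) ∧
      ∀ δ < γ, firstIndex len word w δ < firstIndex len word w γ := by
  induction γ using WellFoundedLT.induction with
  | ind γ ih =>
    obtain ⟨B, hB, hlt⟩ := hκ.exists_bound_of_lt_ord hγ
      (F := firstIndex len word w) fun δ hδ => (ih δ hδ (hδ.trans hγ)).1
    obtain ⟨i, hBi, hi, hi1, hi2⟩ := henum γ hγ w B hB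
    have hmem : i ∈ {i | len i = γ ∧ (∀ ξ < ω * (γ + 1), word i ξ = w ξ) ∧
        ∀ δ (_ : δ < γ), firstIndex len word w δ < i} :=
      ⟨hi1, hi2, fun δ hδ => (hlt δ hδ).trans_le hBi⟩
    have hs := csInf_mem ⟨i, hmem⟩
    have hle := csInf_le' hmem
    rw [← firstIndex] at hs hle
    exact ⟨hle.trans_lt hi, hs⟩

end FirstIndex

/-! ### The oracle for a continuous function. -/

namespace KappaTM

open Order Ordinal

variable {κ : Cardinal.{u}}

theorem Tape.read_coe (x : Tape κ) (ξ : Set.Iio κ.ord) : x.read ξ.1 = x ξ :=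
  dif_pos ξ.2

section Listing

variable (len : Ordinal.{u} → Ordinal.{u}) (word : Ordinal.{u} → Ordinal.{u} → Bool)
  (f : GenCantor κ →. GenCantor κ)

/-- The input `x` extends the `i`-th sequence of an enumeration. -/
def Extends (i : Ordinal.{u}) (x : Tape κ) : Prop :=
  ∀ ξ < ω * (len i + 1), x.read ξ = word i ξ

/-- `b` is the symbol with the number `F y` of `f y`, for all `y` in the domain of `f` that extend
the `i`-th sequence of an enumeration, and `i` is the index that was chosen for this sequence. -/
def IsAnswer (i : Ordinal.{u}) (F : GenCantor κ → Ordinal.{u}) (b : Bool) : Prop :=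
  firstIndex len word (word i) (len i) = i ∧ ∀ y (hy : y ∈ f.Dom), Extends len word i y →
    ∀ ξ : Set.Iio κ.ord, ξ.1 = F y → f.fn y hy ξ = b

open Classical in
/-- A symbol as in `IsAnswer`, if there is one. -/
noncomputable def answer (i : Ordinal.{u}) (F : GenCantor κ → Ordinal.{u}) : Option Bool :=
  if h : ∃ b, IsAnswer len word f i F b then some h.choose else none

open Classical in
/-- The number of symbols of the output that have been found before the index `i`. -/
noncomputable def listed : Ordinal.{u} → GenCantor κ → Ordinal.{u} :=
  -- The recursion treats all inputs at once: whether record `i` carries a symbol depends on `F` at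
  -- every `y`.
  accumulate fun i F x =>
    if Extends len word i x ∧ (answer len word f i F).isSome then F x + 1 else F x

/-- The records for the computation of `f`. -/
noncomputable def listing (i : Ordinal.{u}) : Record.{u} where
  size := ω * (len i + 1)
  word := word i
  out := answer len word f i (listed len word f i)

variable {len word f}

theorem isAnswer_of_answer_eq_some {i : Ordinal.{u}} {F : GenCantor κ → Ordinal.{u}} {b : Bool}
    (h : answer len word f i F = some b) : IsAnswer len word f i F b := by
  rw [answer] at h
  split_ifs at h with h'
  rw [← Option.some.inj h]
  exact h'.choose_spec

theorem IsAnswer.isSome {i : Ordinal.{u}} {F : GenCantor κ → Ordinal.{u}} {b : Bool}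
    (h : IsAnswer len word f i F b) : (answer len word f i F).isSome := by
  rw [answer, dif_pos ⟨b, h⟩]
  rfl

theorem listed_add_one_of_extends {i : Ordinal.{u}} {x : GenCantor κ}
    (h : Extends len word i x ∧ (answer len word f i (listed len word f i)).isSome) :
    listed len word f (i + 1) x = listed len word f i x + 1 :=
  (accumulate_add_one i x).trans (if_pos h)

theorem listed_add_one_of_not {i : Ordinal.{u}} {x : GenCantor κ}
    (h : ¬ (Extends len word i x ∧ (answer len word f i (listed len word f i)).isSome)) :
    listed len word f (i + 1) x = listed len word f i x :=
  (accumulate_add_one i x).trans (if_neg h)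

theorem listed_mono {i j : Ordinal.{u}} (h : i ≤ j) (x : GenCantor κ) :
    listed len word f i x ≤ listed len word f j x :=
  accumulate_mono (fun i F x => by split_ifs; exacts [le_self_add, le_rfl]) h x

variable (hκ : κ.IsRegular) (hlen : ∀ i, len i < κ.ord)
  (henum : ∀ γ < κ.ord, ∀ w : Ordinal.{u} → Bool, ∀ j < κ.ord,
    ∃ i, j ≤ i ∧ i < κ.ord ∧ len i = γ ∧ ∀ ξ < ω * (γ + 1), word i ξ = w ξ)

include hκ hlen henum

/-- If `len j > γ`, then `j` would be the index chosen for a longer segment of `x`, hence larger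
than the one chosen for `γ`. So the word lies within the common segment. -/
theorem extends_of_agree {x y : Tape κ} {γ j : Ordinal.{u}}
    (hxy : ∀ ξ < ω * (γ + 1), x.read ξ = y.read ξ)
    (hj : j < firstIndex len word x.read γ)
    (hlive : firstIndex len word (word j) (len j) = j) (hx : Extends len word j x) :
    Extends len word j y := by
  rcases le_or_gt (len j) γ with h | h
  · intro ξ hξ
    rw [← hxy ξ (hξ.trans_le (by gcongr)), hx ξ hξ]
  · have h1 := (firstIndex_spec hκ henum x.read (hlen j)).2.2.2 γ h
    rw [firstIndex_congr hx, hlive] at h1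
    exact absurd h1 hj.not_gt

/-- Only chosen records carry symbols, and before the index for `γ` these match `x` exactly when
they match `y`. -/
theorem listed_eq_of_agree {x y : GenCantor κ} {γ j : Ordinal.{u}}
    (hxy : ∀ ξ < ω * (γ + 1), Tape.read x ξ = Tape.read y ξ)
    (hj : j ≤ firstIndex len word (Tape.read x) γ) :
    listed len word f j x = listed len word f j y := by
  induction j using Ordinal.limitRecOn with
  | zero => exact (accumulate_zero x).trans (accumulate_zero y).symm
  | add_one j ih =>
    have hj' := Order.add_one_le_iff.1 hj
    have key : Extends len word j x ∧ (answer len word f j (listed len word f j)).isSome ↔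
        Extends len word j y ∧ (answer len word f j (listed len word f j)).isSome := by
      refine and_congr_left fun h => ?_
      obtain ⟨b, hb⟩ := Option.isSome_iff_exists.1 h
      have hlive := (isAnswer_of_answer_eq_some hb).1
      exact ⟨extends_of_agree hκ hlen henum hxy hj' hlive,
        extends_of_agree hκ hlen henum (fun ξ hξ => (hxy ξ hξ).symm)
          (hj'.trans_eq (firstIndex_congr hxy)) hlive⟩
    by_cases h : Extends len word j x ∧ (answer len word f j (listed len word f j)).isSome
    · rw [listed_add_one_of_extends h, listed_add_one_of_extends (key.1 h), ih hj'.le]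
    · rw [listed_add_one_of_not h, listed_add_one_of_not (key.not.1 h), ih hj'.le]
  | limit j hlim ih =>
    refine eq_of_forall_lt_iff fun a => ?_
    refine (lt_accumulate_limit hlim).trans (Iff.trans ?_ (lt_accumulate_limit hlim).symm)
    refine exists_congr fun k => and_congr_right fun hk => ?_
    exact iff_of_eq (congrArg (a < ·) (ih k hk (hk.le.trans hj)))

theorem exists_le_listed (hκ' : Cardinal.aleph0 < κ) (hf : PartialContinuous f)
    {x : GenCantor κ} (hx : x ∈ f.Dom) {α : Ordinal.{u}} (hα : α < κ.ord) :
    ∃ i < κ.ord, α ≤ listed len word f i x := by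
  have hlimκ := Cardinal.isSuccLimit_ord hκ.aleph0_le
  induction α using Ordinal.limitRecOn with
  | zero => exact ⟨0, hlimκ.bot_lt, zero_le⟩
  | add_one α ih =>
    have hα' : α < κ.ord := (lt_add_one α).trans hα
    obtain ⟨i₀, hi₀, hle⟩ := ih hα'
    obtain ⟨β, hβ, hmod⟩ := (GenCantor.partialContinuous_iff hκ' f).1 hf x hx (α + 1) hα
    -- `β` makes the segment decide symbol `α`; `i₀` places the chosen index after `α` symbols are
    -- listed, since `firstIndex` is strictly increasing in the length.
    set γ := max β i₀ with hγdef
    have hγ : γ < κ.ord := max_lt hβ hi₀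
    obtain ⟨hi, hilen, hiword, -⟩ := firstIndex_spec hκ henum (Tape.read x) hγ
    set i := firstIndex len word (Tape.read x) γ with hidef
    have hi₀i : i₀ ≤ i := by
      refine (le_max_right β i₀).trans ?_
      have hind : ∀ δ ≤ γ, δ ≤ firstIndex len word (Tape.read x) δ := by
        intro δ hδ
        induction δ using WellFoundedLT.induction with
        | ind δ ihδ =>
          exact le_of_forall_lt fun ε hε => (ihδ ε hε (hε.le.trans hδ)).trans_lt
            ((firstIndex_spec hκ henum _ (hδ.trans_lt hγ)).2.2.2 ε hε)
      exact hind γ le_rfl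
    have hle' : α ≤ listed len word f i x := hle.trans (listed_mono hi₀i x)
    -- Either symbol `α` is already listed, or it is next for all inputs sharing the segment, and
    -- record `i` supplies it.
    rcases hle'.lt_or_eq with h | h
    · exact ⟨i, hi, Order.add_one_le_of_lt h⟩
    · have hext : Extends len word i x := fun ξ hξ => by
        rw [hilen] at hξ
        exact (hiword ξ hξ).symm
      have hans : IsAnswer len word f i (listed len word f i) (f.fn x hx ⟨α, hα'⟩) := by
        refine ⟨?_, fun y hy hyi ξ hξ => ?_⟩
        · rw [hilen]
          exact firstIndex_congr hiword
        · have hyx : ∀ ζ < ω * (γ + 1), Tape.read x ζ = Tape.read y ζ := fun ζ hζ => by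
            rw [← hilen] at hζ
            rw [hext ζ hζ, hyi ζ hζ]
          rw [← listed_eq_of_agree hκ hlen henum hyx le_rfl, ← h] at hξ
          obtain rfl : ξ = ⟨α, hα'⟩ := Subtype.ext hξ
          refine hmod y hy (fun ζ hζ => ?_) _ (lt_add_one α)
          have hζ' : ζ.1 < ω * (γ + 1) := calc
            ζ.1 < β := hζ
            _ ≤ γ := le_max_left _ _
            _ ≤ γ + 1 := le_self_add
            _ ≤ ω * (γ + 1) := le_mul_of_one_le_left zero_le one_lt_omega0.le
          exact (Tape.read_coe y ζ).symm.trans ((hyx ζ hζ').symm.trans (Tape.read_coe x ζ))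
      exact ⟨i + 1, hlimκ.add_one_lt hi, by rw [listed_add_one_of_extends ⟨hext, hans.isSome⟩, h]⟩
  | limit α hlim ih =>
    have ih' : ∀ α', ∃ i, α' < α → i < κ.ord ∧ α' ≤ listed len word f i x := fun α' => by
      by_cases h : α' < α
      · obtain ⟨i, hi⟩ := ih α' h (h.trans hα)
        exact ⟨i, fun _ => hi⟩
      · exact ⟨0, fun h' => absurd h' h⟩
    choose I hI using ih'
    obtain ⟨B, hB, hlt⟩ := hκ.exists_bound_of_lt_ord hα (F := I) fun δ hδ => (hI δ hδ).1
    refine ⟨B, hB, le_of_forall_lt fun a ha => ?_⟩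
    have ha' := hlim.add_one_lt ha
    exact (lt_add_one a).trans_le ((hI _ ha').2.trans (listed_mono (hlt _ ha').le x))

omit henum in
theorem recordStart_listing_lt (hκ' : Cardinal.aleph0 < κ) {i : Ordinal.{u}} (hi : i < κ.ord) :
    recordStart (listing len word f) i < κ.ord := by
  have hlimκ := Cardinal.isSuccLimit_ord hκ.aleph0_le
  induction i using Ordinal.limitRecOn with
  | zero => exact (accumulate_zero _).trans_lt hlimκ.bot_lt
  | add_one i ih =>
    rw [recordStart_add_one]
    exact hlimκ.add_one_lt (hlimκ.add_one_lt (hlimκ.add_one_lt (isPrincipal_add_ord hκ.aleph0_le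
      (ih ((lt_add_one i).trans hi)) (omega0_mul_add_one_lt_ord hκ' (hlen i)))))
  | limit i hlim ih =>
    obtain ⟨B, hB, hlt⟩ := hκ.exists_bound_of_lt_ord hi fun j hj => ih j hj (hj.trans hi)
    refine lt_of_le_of_lt (le_of_forall_lt fun a ha => ?_) hB
    obtain ⟨j, hj, h⟩ := (lt_accumulate_limit hlim).1 ha
    exact h.trans (hlt j hj)

theorem scanner_computes (hκ' : Cardinal.aleph0 < κ) (hf : PartialContinuous f) :
    Computes scanner (recordTape κ (listing len word f)) f := by
  intro x hx
  refine scanner_writes (L := fun i => listed len word f i x)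
    (fun i => isSuccLimit_mul_left isSuccLimit_omega0 (by simp))
    (fun i hi => recordStart_listing_lt hκ hlen hκ' hi) (accumulate_zero x)
    (fun i _ h h' => listed_add_one_of_extends ⟨h, h'⟩)
    (fun i _ h => listed_add_one_of_not h)
    (fun i _ h a => lt_accumulate_limit h)
    (fun i _ h b hb ξ hξ => (isAnswer_of_answer_eq_some hb).2 x hx h ξ hξ)
    fun α hα => exists_le_listed hκ hlen henum hκ' hf hx hα

end Listing

end KappaTM

theorem theorem1 (κ : Cardinal.{u}) (huncountable : Cardinal.aleph0 < κ)
    (hpow : Cardinal.powerlt κ κ = κ) (f : GenCantor κ →. GenCantor κ) :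
    PartialContinuous f ↔ KappaTM.ComputableWithOracle f := by
  constructor
  · intro hf
    obtain ⟨len, word, hlen, henum⟩ := exists_cofinal_enumeration huncountable hpow
    exact ⟨_, _, KappaTM.scanner_computes
      (Cardinal.isRegular_of_powerlt_eq huncountable.le hpow) hlen henum huncountable hf⟩
  · rintro ⟨M, o, h⟩
    exact h.partialContinuous huncountable
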